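/- **Definitions.** Let $\mathcal M\subseteq\mathcal B(\mathcal H)$ be a von Neumann algebra on a complex Hilbert space $\mathcal H$; "projection" means orthogonal projection. A *quantum metric* on $\mathcal M$ is a family $\mathbb V=\{\mathcal V_t\}_{t\in[0,\infty)}$ of weak*-closed self-adjoint subspaces of $\mathcal B(\mathcal H)$ with $\mathcal V_0=\mathcal M'$, $\mathcal V_s\mathcal V_t\subseteq\mathcal V_{s+t}$ for all $s,t\ge 0$, and $\mathcal V_t=\bigcap_{s>t}\mathcal V_s$ for all $t\ge 0$; then $(\mathcal M,\mathbb V)$ is a *quantum metric space*. It is *reflexive* if for every $t\geq 0$, $\mathcal V_t=\{B\in\mathcal B(\mathcal H): P\mathcal V_tQ=\{0\}\Rightarrow PBQ=0 \text{ for all projections } P,Q\in\mathcal B(\mathcal H)\}$. All infima and suprema below are taken in $[0,\infty]$ (so $\inf\emptyset=\infty$ and $\sup\emptyset=0$). Let $\mathcal M\overline\otimes\mathcal B(\ell_2)$ be the weak*-closure of the algebraic tensor product in $\mathcal B(\mathcal H\otimes_2\ell_2)$. For projections $P,Q\in\mathcal M\overline\otimes\mathcal B(\ell_2)$ let $\operatorname{dist}(P,Q)=\inf\{t: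 P(A\otimes\mathrm{id})Q\ne0\text{ for some }A\in\mathcal V_t\}$, and for projections $P,Q\in\mathcal M$ let $\operatorname{dist}(P,Q)=\inf\{t: PAQ\neq 0\text{ for some }A\in\mathcal V_t\}$. For a projection $P\in\mathcal M$ let $$\operatorname{diam}(P)=\sup\{\operatorname{dist}(Q,R): Q,R\in\mathcal M\overline\otimes\mathcal B(\ell_2)\text{ projections},\ Q(PAP\otimes\mathrm{id})R\ne0\text{ for some }A\in\mathcal B(\mathcal H)\}$$ (so $\operatorname{diam}(0)=0$), and for $r>0$ let $(P)_r=\mathrm{id}-\bigvee\{Q\in\mathcal M\text{ a projection}:\operatorname{dist}(P,Q)\ge r\}$. A set $\mathscr P$ of projections in $\mathcal M$ is a *cover* if $\bigvee_{P\in\mathscr P}P=\mathrm{id}$, is *$r$-disjoint* if $(P)_r(Q)_r=0$ for all $P\neq Q$ in $\mathscr P$, and is *uniformly bounded* if there is $R\in(0,\infty)$ with $\operatorname{diam}(P)\le R$ for all $P\in\mathscr P$. For an integer $k\ge0$, $\operatorname{asdim}(\mathcal M)\le k$ means that for every $r>0$ there are uniformly bounded, $r$-disjoint sets $\mathscr P^0,\dots,\mathscr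 P^k$ of projections in $\mathcal M$ whose union is a cover. The *asymptotic dimension* $\operatorname{asdim}(\mathcal M)$ is the least such $k$, and $\infty$ if there is none. A *quantum function* $\phi:\mathcal M\to\mathcal N$ is a unital weak*-continuous $*$-homomorphism. For quantum metric spaces $\mathcal M,\mathcal N$ and $t\ge0$ put $$\tilde\omega_\phi(t)=\inf\{\operatorname{dist}(\phi(P),\phi(Q)):\operatorname{dist}(P,Q)\ge t\},\qquad \tilde\rho_\phi(t)=\sup\{\operatorname{diam}(\phi(P)):\operatorname{diam}(P)\le t\},$$ where $P,Q$ range over projections in $\mathcal M$. $\phi$ is a *quantum coarse embedding* if $\lim_{t\to\infty}\tilde\omega_\phi(t)=\infty$ and $\tilde\rho_\phi(t)<\infty$ for all $t\geq 0$. A family $\{\phi_\alpha:\mathcal M\to\mathcal N_\alpha\}$ of quantum coarse embeddings is *equi-coarse* if there are functions $f,g:[0,\infty)\to[0,\infty]$ with $\lim_{s\to\infty}f(s)=\infty$ and $g(s)<\infty$ for all $s\geq 0$ such that $f(s)\le\tilde\omega_{\phi_\alpha}(s)$ and $\tilde\rho_{\phi_\alpha}(s)\le g(s)$ for all $s\ge0$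 and all $\alpha$. For $n\ge1$ let $M_n=\mathcal B(\mathbb C^n)$ be the algebra of complex $n\times n$ matrices, acting on $\mathbb C^n$. Given $\delta,\varepsilon,t>0$, a quantum metric on $M_n$ satisfies a *$(\delta,\varepsilon,t)$-isoperimetric inequality* if $\operatorname{rank}((P)_\delta)\ge(1+\varepsilon)\operatorname{rank}(P)$ for all projections $P\in M_n$ with $\operatorname{diam}(P)\le t$. **Proposition.** Let $\mathcal M$ be a quantum metric space and fix $\delta,\varepsilon>0$. For every real $t>0$ let $n_t\geq 1$ be an integer, let $(M_{n_t},\mathbb V_t)$ be a reflexive quantum metric space, and let $\phi_t:\mathcal M\to M_{n_t}$ be a quantum coarse embedding, such that the family $\{\phi_t\}_{t>0}$ is equi-coarse. If $M_{n_t}$ satisfies a $(\delta,\varepsilon,t)$-isoperimetric inequality for every $t>0$, then $\operatorname{asdim}(\mathcal M)=\infty$. -/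

import Mathlib

open scoped NNReal ENNReal TensorProduct Topology

noncomputable section

namespace QuantumMetricSpaces

/-! ### The weak-* topology, the amplification of a von Neumann algebra, and projections -/

section Operators

variable {H : Type*} [NormedAddCommGroup H] [InnerProductSpace ℂ H]

variable (H) in
/-- The weak-* (that is, ultraweak) topology on `B(H)`: the coarsest topology for which the
functionals `A ↦ ∑ₙ ⟪yₙ, A xₙ⟫` are continuous, where `(xₙ)` and `(yₙ)` are square-summable
sequences in `H`. -/
@[reducible] def weakStarTopology : TopologicalSpace (H →L[ℂ] H) :=
  ⨅ (x : lp (fun _ : ℕ => H) 2) (y : lp (fun _ : ℕ => H) 2),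
    TopologicalSpace.induced (fun A : H →L[ℂ] H => ∑' n, inner ℂ (y n) (A (x n))) inferInstance

/-- The Hilbert space `ℓ₂`. -/
abbrev EllTwo : Type := lp (fun _ : ℕ => ℂ) 2

variable (H) in
/-- The Hilbert space tensor product of `H` and `ℓ₂`. -/
abbrev Amp : Type _ := UniformSpace.Completion (H ⊗[ℂ] EllTwo)

/-- The operator `A ⊗ B` on the Hilbert space tensor product of `H` and `ℓ₂`. -/
def opTensor (A : H →L[ℂ] H) (B : EllTwo →L[ℂ] EllTwo) : Amp H →L[ℂ] Amp H :=
  (TensorProduct.mapL A B).completion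

variable [CompleteSpace H]

/-- The underlying set of the normal spatial tensor product of `M` and `B(ℓ₂)`: the weak-* closure
in `B(H ⊗ ℓ₂)` of the algebraic tensor product. -/
def ampAlgebra (M : VonNeumannAlgebra H) : Set (Amp H →L[ℂ] Amp H) :=
  @closure _ (weakStarTopology (Amp H))
    (Submodule.span ℂ {T | ∃ A ∈ M, ∃ B : EllTwo →L[ℂ] EllTwo, T = opTensor A B} : Set _)

/-- The join of a set of projections: the orthogonal projection onto the closed linear span of
their ranges. -/
def projSup (S : Set (H →L[ℂ] H)) : H →L[ℂ] H :=
  (⨆ P ∈ S, LinearMap.range P.toLinearMap).topologicalClosure.starProjection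

/-- `P` is an (orthogonal) projection in `M`. -/
def IsProjIn (M : VonNeumannAlgebra H) (P : H →L[ℂ] H) : Prop :=
  IsStarProjection P ∧ P ∈ M

/-- A subspace of `B(H)` is (operator) reflexive. -/
def IsReflexiveSubspace (V : Submodule ℂ (H →L[ℂ] H)) : Prop :=
  (V : Set (H →L[ℂ] H)) = {B | ∀ P Q : H →L[ℂ] H, IsStarProjection P → IsStarProjection Q →
    (∀ A ∈ V, P * A * Q = 0) → P * B * Q = 0}

end Operators

/-! ### Quantum metrics -/

/-- A quantum metric on the von Neumann algebra `M ⊆ B(H)`. -/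
structure QuantumMetric {H : Type*} [NormedAddCommGroup H] [InnerProductSpace ℂ H]
    [CompleteSpace H] (M : VonNeumannAlgebra H) where
  /-- The filtration of `B(H)`. -/
  V : ℝ≥0 → Submodule ℂ (H →L[ℂ] H)
  isClosed' : ∀ t, @IsClosed _ (weakStarTopology H) (V t : Set (H →L[ℂ] H))
  zero' : (V 0 : Set (H →L[ℂ] H)) = M.commutant
  star_mem' : ∀ t, ∀ A ∈ V t, star A ∈ V t
  mul_mem' : ∀ s t, ∀ A ∈ V s, ∀ B ∈ V t, A * B ∈ V (s + t)
  iInf' : ∀ t, V t = ⨅ s > t, V s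

namespace QuantumMetric

variable {H : Type*} [NormedAddCommGroup H] [InnerProductSpace ℂ H] [CompleteSpace H]
  {M : VonNeumannAlgebra H} (𝕍 : QuantumMetric M)

/-- The distance between projections `P, Q ∈ M` (possibly infinite). -/
def dist (P Q : H →L[ℂ] H) : ℝ≥0∞ :=
  ⨅ (t : ℝ≥0) (_ : ∃ A ∈ 𝕍.V t, P * A * Q ≠ 0), (t : ℝ≥0∞)

/-- The distance between projections `P, Q` in the amplification of `M` by `B(ℓ₂)`
(possibly infinite). -/
def ampDist (P Q : Amp H →L[ℂ] Amp H) : ℝ≥0∞ :=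
  ⨅ (t : ℝ≥0) (_ : ∃ A ∈ 𝕍.V t, P * opTensor A 1 * Q ≠ 0), (t : ℝ≥0∞)

/-- The diameter of a projection `P ∈ M` (possibly infinite); for `P = 0` the supremum is over the
empty set, and so it is zero. -/
def diam (P : H →L[ℂ] H) : ℝ≥0∞ :=
  ⨆ (Q : Amp H →L[ℂ] Amp H) (R : Amp H →L[ℂ] Amp H)
    (_ : IsStarProjection Q ∧ Q ∈ ampAlgebra M) (_ : IsStarProjection R ∧ R ∈ ampAlgebra M)
    (_ : ∃ A : H →L[ℂ] H, Q * opTensor (P * A * P) 1 * R ≠ 0), 𝕍.ampDist Q R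

/-- The open `ε`-neighborhood `(P)_ε` of a projection `P ∈ M`. -/
def nhd (P : H →L[ℂ] H) (ε : ℝ≥0) : H →L[ℂ] H :=
  1 - projSup {Q | IsProjIn M Q ∧ (ε : ℝ≥0∞) ≤ 𝕍.dist P Q}

/-- A quantum metric is reflexive if each member of the filtration is. -/
def IsReflexive : Prop := ∀ t, IsReflexiveSubspace (𝕍.V t)

/-- A family of projections is `r`-disjoint. -/
def IsDisjointFamily (r : ℝ≥0) (F : Set (H →L[ℂ] H)) : Prop :=
  ∀ P ∈ F, ∀ Q ∈ F, P ≠ Q → 𝕍.nhd P r * 𝕍.nhd Q r = 0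

/-- A family of projections is uniformly bounded. -/
def IsUniformlyBounded (F : Set (H →L[ℂ] H)) : Prop :=
  ∃ R : ℝ≥0, 0 < R ∧ ∀ P ∈ F, 𝕍.diam P ≤ R

/-- The asymptotic dimension is at most `n`. -/
def AsdimLE (n : ℕ) : Prop :=
  ∀ r : ℝ≥0, 0 < r → ∃ F : Fin (n + 1) → Set (H →L[ℂ] H),
    (∀ i, (∀ P ∈ F i, IsProjIn M P) ∧ 𝕍.IsUniformlyBounded (F i) ∧ 𝕍.IsDisjointFamily r (F i)) ∧
    projSup (⋃ i, F i) = 1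

/-- The asymptotic dimension; it is `⊤` if there is no `n` such that it is at most `n`. -/
def asdim : ℕ∞ := ⨅ (n : ℕ) (_ : 𝕍.AsdimLE n), (n : ℕ∞)

end QuantumMetric

/-! ### Quantum functions and coarse embeddings -/

section Functions

variable {H : Type*} [NormedAddCommGroup H] [InnerProductSpace ℂ H] [CompleteSpace H]
  {K : Type*} [NormedAddCommGroup K] [InnerProductSpace ℂ K] [CompleteSpace K]

/-- A quantum function `M → N`: a unital weak-*-continuous `*`-homomorphism. -/
structure QuantumFunction (M : VonNeumannAlgebra H) (N : VonNeumannAlgebra K) extends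
    M.toStarSubalgebra →⋆ₐ[ℂ] N.toStarSubalgebra where
  continuous' : @Continuous _ _
    (TopologicalSpace.induced Subtype.val (weakStarTopology H))
    (TopologicalSpace.induced Subtype.val (weakStarTopology K)) toFun

namespace QuantumFunction

variable {M : VonNeumannAlgebra H} {N : VonNeumannAlgebra K}
  (𝕍 : QuantumMetric M) (𝕎 : QuantumMetric N) (φ : QuantumFunction M N)

/-- The modulus `t ↦ inf {dist (φ P, φ Q) | dist (P, Q) ≥ t}`, over projections `P, Q` in `M`. -/
def omegaTilde (t : ℝ≥0) : ℝ≥0∞ :=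
  ⨅ (P : M.toStarSubalgebra) (Q : M.toStarSubalgebra)
    (_ : IsStarProjection P) (_ : IsStarProjection Q)
    (_ : (t : ℝ≥0∞) ≤ 𝕍.dist P Q), 𝕎.dist (φ.toStarAlgHom P) (φ.toStarAlgHom Q)

/-- The modulus `t ↦ sup {diam (φ P) | diam P ≤ t}`, over projections `P` in `M`. -/
def rhoTilde (t : ℝ≥0) : ℝ≥0∞ :=
  ⨆ (P : M.toStarSubalgebra) (_ : IsStarProjection P) (_ : 𝕍.diam P ≤ t),
    𝕎.diam (φ.toStarAlgHom P)

/-- The quantum function `φ` is a (quantum) coarse embedding. -/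
def IsCoarseEmbedding : Prop :=
  Filter.Tendsto (φ.omegaTilde 𝕍 𝕎) Filter.atTop (𝓝 ⊤) ∧ ∀ t, φ.rhoTilde 𝕍 𝕎 t < ⊤

end QuantumFunction

/-- A family of quantum coarse embeddings with the common domain `M` is equi-coarse. -/
def IsEquiCoarse {M : VonNeumannAlgebra H} (𝕍 : QuantumMetric M) {ι : Type*} {L : ι → Type*}
    [∀ i, NormedAddCommGroup (L i)] [∀ i, InnerProductSpace ℂ (L i)] [∀ i, CompleteSpace (L i)]
    {N : ∀ i, VonNeumannAlgebra (L i)} (𝕎 : ∀ i, QuantumMetric (N i))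
    (φ : ∀ i, QuantumFunction M (N i)) : Prop :=
  ∃ f g : ℝ≥0 → ℝ≥0∞, Filter.Tendsto f Filter.atTop (𝓝 ⊤) ∧ (∀ t, g t < ⊤) ∧
    ∀ t i, f t ≤ (φ i).omegaTilde 𝕍 (𝕎 i) t ∧ (φ i).rhoTilde 𝕍 (𝕎 i) t ≤ g t

end Functions

/-! ### Matrix algebras -/

/-- The matrix algebra `M_n`, that is, all operators on `ℂⁿ`, as a von Neumann algebra. -/
def matrixAlgebra (n : ℕ) : VonNeumannAlgebra (EuclideanSpace ℂ (Fin n)) where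
  toStarSubalgebra := ⊤
  centralizer_centralizer' := by
    refine Set.eq_univ_of_forall fun a b hb => ?_
    exact (hb a (Set.mem_univ a)).symm

/-- The rank of an operator on `ℂⁿ`. -/
def rank {n : ℕ} (P : EuclideanSpace ℂ (Fin n) →L[ℂ] EuclideanSpace ℂ (Fin n)) : ℕ :=
  Module.finrank ℂ (LinearMap.range P.toLinearMap)

/-- A quantum metric on `M_n` satisfies a `(δ, ε, t)`-isoperimetric inequality. -/
def IsoperimetricInequality {n : ℕ} (𝕍 : QuantumMetric (matrixAlgebra n)) (δ ε t : ℝ≥0) : Prop :=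
  ∀ P, IsProjIn (matrixAlgebra n) P → 𝕍.diam P ≤ t →
    (1 + (ε : ℝ)) * (rank P : ℝ) ≤ (rank (𝕍.nhd P δ) : ℝ)

end QuantumMetricSpaces

end

/-! Suppose the asymptotic dimension were at most `k`. Choose `m` with `(1 + ε) ^ (m + 1) > k + 1`,
a scale `r` at which every `φ t` keeps `r`-separated projections at least `(m + 1) * δ` apart, and a
cover by `k + 1` uniformly bounded `r`-disjoint families. Equi-coarseness bounds the diameters of
the images by some `d` independent of `t`, so `t` can be taken as large as `d + (m + 1) * 2δ`.

In the matrix algebra of size `n t` the images still have join one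
(`QuantumFunction.eq_zero_of_projSup_eq_one`, which needs weak-* continuity), so finitely many of
them have ranks summing to at least `n t`. Taking the `δ`-neighborhood `m + 1` times multiplies each
rank by at least `(1 + ε) ^ (m + 1)`, because each step enlarges the diameter by at most `2δ`
(`diam_nhd_le`) and the isoperimetric inequality stays applicable. Within one family the iterated
neighborhoods remain mutually orthogonal, since that of `φ P` lies under `φ` of the `r`-neighborhood
of `P` (`QuantumFunction.iterate_nhd_mul_eq_zero`); so each family contributes rank at most `n t`.
Hence `(1 + ε) ^ (m + 1) * n t ≤ (k + 1) * n t`, a contradiction. -/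

namespace QuantumMetricSpaces

/-! ### Projections and joins, described by what annihilates them -/

section Projections

variable {H : Type*} [NormedAddCommGroup H] [InnerProductSpace ℂ H] [CompleteSpace H]

theorem mul_starProjection_topologicalClosure_eq_zero_iff (U : Submodule ℂ H) (X : H →L[ℂ] H) :
    X * U.topologicalClosure.starProjection = 0 ↔ ∀ u ∈ U, X u = 0 := by
  constructor
  · intro h u hu
    have h1 := congrArg (fun T : H →L[ℂ] H => T u) h
    simpa [Submodule.starProjection_eq_self_iff.mpr (U.le_topologicalClosure hu)] using h1
  · intro h
    have hle : U.topologicalClosure ≤ LinearMap.ker X.toLinearMap :=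
      Submodule.topologicalClosure_minimal _ (fun u hu => h u hu) X.isClosed_ker
    ext x
    exact hle (Submodule.starProjection_apply_mem _ x)

/-- The projection onto the closure of the range of an operator. -/
theorem exists_isStarProjection_mul_eq_zero_iff (T : H →L[ℂ] H) :
    ∃ R : H →L[ℂ] H, IsStarProjection R ∧ ∀ X : H →L[ℂ] H, X * R = 0 ↔ X * T = 0 := by
  refine ⟨(LinearMap.range T.toLinearMap).topologicalClosure.starProjection,
    isStarProjection_starProjection, fun X => ?_⟩
  rw [mul_starProjection_topologicalClosure_eq_zero_iff]
  constructor
  · intro h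
    ext x
    exact h _ ⟨x, rfl⟩
  · rintro h _ ⟨x, rfl⟩
    exact congrArg (fun T : H →L[ℂ] H => T x) h

/-- The projection onto the orthogonal complement of the kernel of an operator. -/
theorem exists_isStarProjection_mul_eq_zero_iff' (T : H →L[ℂ] H) :
    ∃ R : H →L[ℂ] H, IsStarProjection R ∧ ∀ X : H →L[ℂ] H, R * X = 0 ↔ T * X = 0 := by
  obtain ⟨R, hR, h⟩ := exists_isStarProjection_mul_eq_zero_iff (star T)
  refine ⟨R, hR, fun X => ?_⟩
  rw [← star_eq_zero, star_mul, hR.isSelfAdjoint.star_eq, h, ← star_mul, star_eq_zero]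

theorem isStarProjection_projSup (S : Set (H →L[ℂ] H)) : IsStarProjection (projSup S) :=
  isStarProjection_starProjection

/-- Kernels of bounded operators are closed subspaces, so killing each range kills the closed span.
Distances and neighborhoods are defined by vanishing products, so this is the main way in which
joins are used. -/
theorem mul_projSup_eq_zero_iff (S : Set (H →L[ℂ] H)) (X : H →L[ℂ] H) :
    X * projSup S = 0 ↔ ∀ P ∈ S, X * P = 0 := by
  rw [projSup, mul_starProjection_topologicalClosure_eq_zero_iff]
  change (⨆ P ∈ S, LinearMap.range P.toLinearMap) ≤ LinearMap.ker X.toLinearMap ↔ _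
  simp only [iSup_le_iff]
  refine forall₂_congr fun P _ => ⟨fun h => ?_, ?_⟩
  · ext x
    exact h ⟨x, rfl⟩
  · rintro h _ ⟨x, rfl⟩
    exact congrArg (fun T : H →L[ℂ] H => T x) h

theorem one_sub_projSup_mul_eq_zero {S : Set (H →L[ℂ] H)} {P : H →L[ℂ] H} (hP : P ∈ S) :
    (1 - projSup S) * P = 0 :=
  (mul_projSup_eq_zero_iff S _).mp (isStarProjection_projSup S).one_sub_mul_self P hP

/-- By the bicommutant property a projection lies in `M` as soon as its range is invariant under the
commutant, and invariance passes to closed spans. -/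
theorem isProjIn_projSup {M : VonNeumannAlgebra H} {S : Set (H →L[ℂ] H)} (hS : ∀ P ∈ S, P ∈ M) :
    IsProjIn M (projSup S) := by
  refine ⟨isStarProjection_projSup S, ?_⟩
  rw [VonNeumannAlgebra.IsStarProjection.mem_iff (isStarProjection_projSup S)]
  intro y hy
  have hU : (⨆ P ∈ S, LinearMap.range P.toLinearMap)
      ≤ (⨆ P ∈ S, LinearMap.range P.toLinearMap).topologicalClosure.comap y.toLinearMap := by
    refine iSup₂_le fun P hP => ?_
    rintro _ ⟨x, rfl⟩
    refine Submodule.le_topologicalClosure _ (Submodule.mem_iSup_of_mem P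
      (Submodule.mem_iSup_of_mem hP ⟨y x, ?_⟩))
    exact congrArg (fun T : H →L[ℂ] H => T x)
      (VonNeumannAlgebra.mem_commutant_iff.mp hy P (hS P hP))
  have hr : LinearMap.range (projSup S).toLinearMap
      = (⨆ P ∈ S, LinearMap.range P.toLinearMap).topologicalClosure :=
    Submodule.range_starProjection _
  change LinearMap.range (projSup S).toLinearMap ≤ _
  rw [hr]
  exact Submodule.topologicalClosure_minimal _ hU
    ((Submodule.isClosed_topologicalClosure _).preimage y.continuous)

end Projections

/-! ### Distances and neighborhoods -/

namespace QuantumMetric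

variable {H : Type*} [NormedAddCommGroup H] [InnerProductSpace ℂ H] [CompleteSpace H]
  {M : VonNeumannAlgebra H} (𝕍 : QuantumMetric M)

theorem le_dist_iff {s : ℝ≥0} {P Q : H →L[ℂ] H} :
    (s : ℝ≥0∞) ≤ 𝕍.dist P Q ↔ ∀ t < s, ∀ A ∈ 𝕍.V t, P * A * Q = 0 := by
  simp only [dist, le_iInf_iff, ENNReal.coe_le_coe]
  constructor
  · intro h t ht A hA
    by_contra hne
    exact absurd (h t ⟨A, hA, hne⟩) (not_le.mpr ht)
  · rintro h t ⟨A, hA, hne⟩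
    by_contra hlt
    exact hne (h t (not_le.mp hlt) A hA)

theorem isProjIn_nhd (P : H →L[ℂ] H) (r : ℝ≥0) : IsProjIn M (𝕍.nhd P r) := by
  have h : IsProjIn M (projSup {Q | IsProjIn M Q ∧ (r : ℝ≥0∞) ≤ 𝕍.dist P Q}) :=
    isProjIn_projSup fun Q hQ => hQ.1.2
  exact ⟨h.1.one_sub, sub_mem (one_mem M) h.2⟩

/-- The complement of the neighborhood is a join of projections far from `P`, and a join of far
projections is again far. -/
theorem le_dist_one_sub_nhd (P : H →L[ℂ] H) (r : ℝ≥0) :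
    (r : ℝ≥0∞) ≤ 𝕍.dist P (1 - 𝕍.nhd P r) := by
  rw [nhd, sub_sub_cancel, le_dist_iff]
  intro t ht A hA
  rw [mul_projSup_eq_zero_iff]
  exact fun Q hQ => (𝕍.le_dist_iff.mp hQ.2) t ht A hA

theorem nhd_mul_eq_zero {P Q : H →L[ℂ] H} {r : ℝ≥0} (hQ : IsProjIn M Q)
    (h : (r : ℝ≥0∞) ≤ 𝕍.dist P Q) : 𝕍.nhd P r * Q = 0 :=
  one_sub_projSup_mul_eq_zero ⟨hQ, h⟩

end QuantumMetric

/-! ### Weak-* convergence and vector functionals -/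

section WeakStar

open Filter

theorem summable_norm_mul_norm {E : Type*} [NormedAddCommGroup E] (x y : lp (fun _ : ℕ => E) 2) :
    Summable fun n => ‖y n‖ * ‖x n‖ := by
  have hx : Summable fun n => ‖x n‖ ^ 2 := by
    simpa using (lp.memℓp x).summable (by norm_num)
  have hy : Summable fun n => ‖y n‖ ^ 2 := by
    simpa using (lp.memℓp y).summable (by norm_num)
  refine Summable.of_nonneg_of_le (fun n => by positivity) (fun n => ?_) (hx.add hy)
  nlinarith [sq_nonneg (‖x n‖ - ‖y n‖), sq_nonneg (‖x n‖), sq_nonneg (‖y n‖)]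

variable {H : Type*} [NormedAddCommGroup H] [InnerProductSpace ℂ H]

/-- Bounded strongly convergent nets are weak-* convergent. -/
theorem tendsto_weakStarTopology {ι : Type*} {l : Filter ι} {f : ι → H →L[ℂ] H} {A : H →L[ℂ] H}
    {C : ℝ} (hC : ∀ i, ‖f i‖ ≤ C) (h : ∀ x, Tendsto (fun i => f i x) l (𝓝 (A x))) :
    Tendsto f l (@nhds _ (weakStarTopology H) A) := by
  simp only [nhds_iInf, nhds_induced, tendsto_iInf, tendsto_comap_iff]
  intro x y
  refine tendsto_tsum_of_dominated_convergence (bound := fun n => C * (‖y n‖ * ‖x n‖))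
    ((summable_norm_mul_norm x y).mul_left C) (fun n => tendsto_const_nhds.inner (h (x n))) ?_
  refine Eventually.of_forall fun i n => ?_
  calc ‖inner ℂ (y n) (f i (x n))‖ ≤ ‖y n‖ * ‖f i (x n)‖ := norm_inner_le_norm _ _
    _ ≤ ‖y n‖ * (C * ‖x n‖) := by gcongr; exact (f i).le_of_opNorm_le (hC i) _
    _ = C * (‖y n‖ * ‖x n‖) := by ring

/-- Vector functionals are weak-* continuous. -/
theorem continuous_weakStarTopology_inner (x y : H) :
    @Continuous _ _ (weakStarTopology H) _ (fun A : H →L[ℂ] H => inner ℂ y (A x)) := by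
  have h : (fun A : H →L[ℂ] H => inner ℂ y (A x)) = fun A : H →L[ℂ] H =>
      ∑' n, inner ℂ (lp.single (E := fun _ : ℕ => H) 2 0 y n)
        (A (lp.single (E := fun _ : ℕ => H) 2 0 x n)) := by
    funext A
    rw [tsum_eq_single 0]
    · simp
    · intro n hn
      simp [Pi.single_eq_of_ne hn]
  rw [h]
  exact continuous_iInf_dom (continuous_iInf_dom continuous_induced_dom)

end WeakStar

/-! ### Amplification of `B(H)`: every operator on the tensor product is a weak-* limit -/

section Amplification

open Filter InnerProductSpace

variable {H : Type*} [NormedAddCommGroup H] [InnerProductSpace ℂ H]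

theorem opTensor_coe_tmul (A : H →L[ℂ] H) (B : EllTwo →L[ℂ] EllTwo) (x : H) (y : EllTwo) :
    opTensor A B ((x ⊗ₜ[ℂ] y : H ⊗[ℂ] EllTwo) : Amp H)
      = ((A x ⊗ₜ[ℂ] B y : H ⊗[ℂ] EllTwo) : Amp H) := by
  simp [opTensor]

/-- Operators on the amplification that agree on elementary tensors are equal. -/
theorem amp_ext {S T : Amp H →L[ℂ] Amp H}
    (h : ∀ (x : H) (y : EllTwo), S ((x ⊗ₜ[ℂ] y : H ⊗[ℂ] EllTwo) : Amp H)
      = T ((x ⊗ₜ[ℂ] y : H ⊗[ℂ] EllTwo) : Amp H)) : S = T := by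
  refine ContinuousLinearMap.ext fun z => ?_
  induction z using UniformSpace.Completion.induction_on with
  | hp => exact isClosed_eq S.continuous T.continuous
  | ih z =>
    induction z using TensorProduct.induction_on with
    | zero => rw [UniformSpace.Completion.coe_zero, map_zero, map_zero]
    | tmul x y => exact h x y
    | add x y hx hy => simp only [UniformSpace.Completion.coe_add, map_add, hx, hy]

theorem opTensor_mul_one (A B : H →L[ℂ] H) :
    opTensor (A * B) 1 = opTensor A 1 * opTensor B 1 :=
  amp_ext fun x y => by simp [opTensor_coe_tmul]

theorem opTensor_add_one (A B : H →L[ℂ] H) :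
    opTensor (A + B) 1 = opTensor A 1 + opTensor B 1 :=
  amp_ext fun x y => by
    simp [opTensor_coe_tmul, TensorProduct.add_tmul, UniformSpace.Completion.coe_add]

theorem opTensor_smul_one (c : ℂ) (A : H →L[ℂ] H) :
    opTensor (c • A) 1 = c • opTensor A 1 :=
  amp_ext fun x y => by
    simp [opTensor_coe_tmul, ← TensorProduct.smul_tmul', UniformSpace.Completion.coe_smul]

theorem opTensor_zero_one : opTensor (0 : H →L[ℂ] H) 1 = 0 := by
  simpa using opTensor_smul_one (0 : ℂ) (0 : H →L[ℂ] H)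

theorem opTensor_rankOne (a b : H) (c d : EllTwo) :
    opTensor (rankOne ℂ a b) (rankOne ℂ c d)
      = rankOne ℂ ((a ⊗ₜ[ℂ] c : H ⊗[ℂ] EllTwo) : Amp H)
          ((b ⊗ₜ[ℂ] d : H ⊗[ℂ] EllTwo) : Amp H) :=
  amp_ext fun x y => by
    simp only [opTensor_coe_tmul, rankOne_apply, UniformSpace.Completion.inner_coe,
      TensorProduct.inner_tmul, TensorProduct.smul_tmul_smul, UniformSpace.Completion.coe_smul]

theorem rankOne_mem_span {E : Type*} [NormedAddCommGroup E] [InnerProductSpace ℂ E] {S : Set E}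
    {u v : E} (hu : u ∈ Submodule.span ℂ S) (hv : v ∈ Submodule.span ℂ S) :
    rankOne ℂ u v ∈ Submodule.span ℂ {T : E →L[ℂ] E | ∃ a ∈ S, ∃ b ∈ S, T = rankOne ℂ a b} := by
  induction hu using Submodule.span_induction with
  | zero => simp
  | add x y _ _ hx hy => simpa using add_mem hx hy
  | smul c x _ hx => simpa using Submodule.smul_mem _ c hx
  | mem a ha =>
    induction hv using Submodule.span_induction with
    | zero => simp
    | add x y _ _ hx hy => simpa using add_mem hx hy
    | smul c x _ hx => simpa [map_smulₛₗ] using Submodule.smul_mem _ (starRingEnd ℂ c) hx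
    | mem b hb => exact Submodule.subset_span ⟨a, ha, b, hb, rfl⟩

/-- The compression of an operator to the span of a finite set is a combination of the rank one
operators defined by this set. -/
theorem starProjection_mul_mul_mem_span {E : Type*} [NormedAddCommGroup E] [InnerProductSpace ℂ E]
    {S : Set E} [FiniteDimensional ℂ (Submodule.span ℂ S)] (T : E →L[ℂ] E) :
    (Submodule.span ℂ S).starProjection * T * (Submodule.span ℂ S).starProjection
      ∈ Submodule.span ℂ {T : E →L[ℂ] E | ∃ a ∈ S, ∃ b ∈ S, T = rankOne ℂ a b} := by
  let b := stdOrthonormalBasis ℂ (Submodule.span ℂ S)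
  have h : (Submodule.span ℂ S).starProjection * T * (Submodule.span ℂ S).starProjection
      = ∑ i, rankOne ℂ ((Submodule.span ℂ S).starProjection (T (b i))) (b i : E) := by
    ext x
    have hx : (Submodule.span ℂ S).starProjection x = ∑ i, inner ℂ (b i : E) x • (b i : E) := by
      rw [Submodule.starProjection_apply, b.orthogonalProjectionOnto_apply_eq_sum]
      simp
    simp only [mul_apply_eq_comp, sum_apply, rankOne_apply]
    conv_lhs => rw [hx]
    simp
  rw [h]
  exact Submodule.sum_mem _ fun i _ =>
    rankOne_mem_span (Submodule.starProjection_apply_mem _ _) (b i).2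

theorem span_elementary_tensors_dense :
    ⊤ ≤ (Submodule.span ℂ (Set.range fun p : H × EllTwo =>
      ((p.1 ⊗ₜ[ℂ] p.2 : H ⊗[ℂ] EllTwo) : Amp H))).topologicalClosure := by
  rintro z -
  induction z using UniformSpace.Completion.induction_on with
  | hp => exact Submodule.isClosed_topologicalClosure _
  | ih z =>
    induction z using TensorProduct.induction_on with
    | zero => exact zero_mem _
    | tmul x y => exact Submodule.le_topologicalClosure _ (Submodule.subset_span ⟨(x, y), rfl⟩)
    | add x y hx hy =>
      rw [UniformSpace.Completion.coe_add]
      exact add_mem hx hy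

/-- The amplification of the algebra of all operators consists of all operators. -/
theorem mem_ampAlgebra_of_forall_mem [CompleteSpace H] {M : VonNeumannAlgebra H}
    (hM : ∀ A, A ∈ M) (T : Amp H →L[ℂ] Amp H) : T ∈ ampAlgebra M := by
  classical
  let e : H × EllTwo → Amp H := fun p => ((p.1 ⊗ₜ[ℂ] p.2 : H ⊗[ℂ] EllTwo) : Amp H)
  -- The compressions of `T` to spans of finitely many elementary tensors lie in the algebraic
  -- tensor product and converge strongly to `T` with norm at most `‖T‖`.
  let U : Finset (H × EllTwo) → Submodule ℂ (Amp H) := fun s => Submodule.span ℂ (e '' s)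
  have hfin : ∀ s, FiniteDimensional ℂ (U s) := fun s =>
    FiniteDimensional.span_of_finite ℂ (s.finite_toSet.image e)
  have hmono : Monotone U := fun s t hst =>
    Submodule.span_mono (Set.image_mono (Finset.coe_subset.mpr hst))
  have hdense : ⊤ ≤ (⨆ s, U s).topologicalClosure := by
    refine span_elementary_tensors_dense.trans (Submodule.topologicalClosure_mono ?_)
    rw [Submodule.span_le]
    rintro _ ⟨p, rfl⟩
    exact Submodule.mem_iSup_of_mem {p} (Submodule.subset_span ⟨p, by simp, rfl⟩)
  have hlim : ∀ x, Tendsto (fun s => (U s).starProjection x) atTop (𝓝 x) := fun x =>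
    Submodule.starProjection_tendsto_self U hmono x hdense
  have hT : Tendsto (fun s => (U s).starProjection * T * (U s).starProjection) atTop
      (@nhds _ (weakStarTopology (Amp H)) T) := by
    refine tendsto_weakStarTopology (C := ‖T‖) (fun s => ?_) (fun x => ?_)
    · calc ‖(U s).starProjection * T * (U s).starProjection‖
          ≤ ‖(U s).starProjection‖ * ‖T‖ * ‖(U s).starProjection‖ :=
            (norm_mul_le _ _).trans (by gcongr; exact norm_mul_le _ _)
        _ ≤ 1 * ‖T‖ * 1 := by gcongr <;> exact Submodule.starProjection_norm_le _
        _ = ‖T‖ := by ring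
    -- Writing `p` for the compression, `p T p x = p T (p x - x) + p (T x)`; the first term tends to
    -- zero and the second to `T x`.
    · have h1 : Tendsto (fun s => (U s).starProjection (T ((U s).starProjection x - x))) atTop
          (𝓝 0) := by
        have h2 : Tendsto (fun s => ‖T ((U s).starProjection x - x)‖) atTop (𝓝 0) := by
          have h3 := (T.continuous.tendsto _).comp ((hlim x).sub_const x)
          simpa using h3.norm
        refine squeeze_zero_norm (fun s => ?_) h2
        exact Submodule.norm_starProjection_apply_le _ _
      have h4 := h1.add (hlim (T x))
      simpa using h4
  refine @mem_closure_of_tendsto _ (weakStarTopology (Amp H)) _ _ _ _ _ _ hT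
    (Eventually.of_forall fun s => ?_)
  refine Submodule.span_mono ?_ (starProjection_mul_mul_mem_span T)
  rintro _ ⟨_, ⟨p, -, rfl⟩, _, ⟨q, -, rfl⟩, rfl⟩
  exact ⟨rankOne ℂ p.1 q.1, hM _, rankOne ℂ p.2 q.2, (opTensor_rankOne _ _ _ _).symm⟩

end Amplification

/-! ### Quantum functions preserve covers -/

section Normality

open Filter

variable {H : Type*} [NormedAddCommGroup H] [InnerProductSpace ℂ H] [CompleteSpace H]
  {K : Type*} [NormedAddCommGroup K] [InnerProductSpace ℂ K] [CompleteSpace K]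
  {M : VonNeumannAlgebra H} {N : VonNeumannAlgebra K}

theorem projSup_eq_one_sub_starProjection (S : Set (H →L[ℂ] H)) :
    1 - projSup S = (⨆ P ∈ S, LinearMap.range P.toLinearMap)ᗮ.starProjection := by
  rw [projSup, ← Submodule.starProjection_orthogonal']
  simp only [Submodule.orthogonal_closure]

/-- A vector fixed by the images of a bounded strongly convergent net is fixed by the image of
its limit. -/
theorem QuantumFunction.apply_eq_of_tendsto (φ : QuantumFunction M N) {ι : Type*} {l : Filter ι}
    [l.NeBot] {f : ι → M.toStarSubalgebra} {A : M.toStarSubalgebra} {C : ℝ}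
    (hC : ∀ i, ‖(f i : H →L[ℂ] H)‖ ≤ C)
    (h : ∀ x, Tendsto (fun i => (f i : H →L[ℂ] H) x) l (𝓝 ((A : H →L[ℂ] H) x))) {v : K}
    (hv : ∀ i, (φ.toStarAlgHom (f i) : K →L[ℂ] K) v = v) :
    (φ.toStarAlgHom A : K →L[ℂ] K) v = v := by
  have h1 : Tendsto f l
      (@nhds _ (TopologicalSpace.induced Subtype.val (weakStarTopology H)) A) := by
    rw [@nhds_induced _ _ (weakStarTopology H), tendsto_comap_iff]
    exact tendsto_weakStarTopology hC h
  have h2 := (@Continuous.tendsto _ _ (_) (_) _ φ.continuous' A).comp h1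
  rw [@nhds_induced _ _ (weakStarTopology K), tendsto_comap_iff] at h2
  refine ext_inner_left ℂ fun w => ?_
  have h3 := (@Continuous.tendsto _ _ (weakStarTopology K) _ _
    (continuous_weakStarTopology_inner v w) _).comp h2
  exact tendsto_nhds_unique h3
    (tendsto_const_nhds.congr fun i => congrArg (inner ℂ w) (hv i).symm)

/-- Pairing the sum with `x` gives `∑ ‖P x‖ ^ 2`, so nothing can cancel. -/
theorem sum_apply_eq_zero_iff {s : Finset (H →L[ℂ] H)} (hs : ∀ P ∈ s, IsStarProjection P) (x : H) :
    (∑ P ∈ s, P) x = 0 ↔ ∀ P ∈ s, P x = 0 := by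
  constructor
  · intro h
    have hsq : ∀ P ∈ s, inner ℂ x (P x) = ((‖P x‖ ^ 2 : ℝ) : ℂ) := fun P hP => by
      have h1 : P (P x) = P x :=
        congrArg (fun T : H →L[ℂ] H => T x) (hs P hP).isIdempotentElem
      have h2 := (hs P hP).isSelfAdjoint.isSymmetric x (P x)
      simp only [ContinuousLinearMap.coe_coe, h1] at h2
      rw [← h2, inner_self_eq_norm_sq_to_K]
      simp
    have h3 : ∑ P ∈ s, ‖P x‖ ^ 2 = 0 := by
      have h4 : inner ℂ x ((∑ P ∈ s, P) x) = 0 := by rw [h, inner_zero_right]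
      rw [sum_apply, inner_sum, Finset.sum_congr rfl hsq] at h4
      exact_mod_cast h4
    intro P hP
    have h5 := (Finset.sum_eq_zero_iff_of_nonneg fun P _ => by positivity).mp h3 P hP
    simpa using h5
  · intro h
    rw [sum_apply]
    exact Finset.sum_eq_zero h

/-- A quantum function preserves finite joins of projections. -/
theorem QuantumFunction.apply_one_sub_projSup_eq (φ : QuantumFunction M N)
    {s : Finset (H →L[ℂ] H)} (hs : ∀ P ∈ s, IsProjIn M P) {v : K}
    (hv : ∀ P (hP : P ∈ s), (φ.toStarAlgHom ⟨P, (hs P hP).2⟩ : K →L[ℂ] K) v = 0)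
    (h1 : 1 - projSup (s : Set (H →L[ℂ] H)) ∈ M.toStarSubalgebra) :
    (φ.toStarAlgHom ⟨1 - projSup (s : Set (H →L[ℂ] H)), h1⟩ : K →L[ℂ] K) v = v := by
  let c : ℂ := ((s.card : ℂ) + 1)⁻¹
  have hc : ((s.card : ℂ) + 1) ≠ 0 := Nat.cast_add_one_ne_zero _
  let T : M.toStarSubalgebra := ∑ P : s, ⟨P.1, (hs P.1 P.2).2⟩
  have hT : (T : H →L[ℂ] H) = ∑ P ∈ s, P := by
    rw [← Finset.sum_coe_sort s]
    simp [T]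
  -- The mean ergodic theorem produces the join inside the algebra: `f` is a contraction whose fixed
  -- vectors are the common kernel of the projections in `s`, so its Cesàro means converge strongly
  -- to the complement of the join. Since `φ f` fixes `v`, so do the images of the means. The `+ 1`
  -- in `c` covers empty `s`.
  let f : M.toStarSubalgebra := 1 - c • T
  have hfv : (f : H →L[ℂ] H) = 1 - c • ∑ P ∈ s, P := by simp [f, hT]
  -- As an average of `1` and the complements `1 - P`, `f` is visibly a contraction.
  have hfc : (f : H →L[ℂ] H) = c • (1 + ∑ P ∈ s, (1 - P)) := by
    rw [hfv, Finset.sum_sub_distrib, Finset.sum_const, ← Nat.cast_smul_eq_nsmul ℂ, smul_add,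
      smul_sub, smul_smul, ← add_sub_assoc, ← add_smul]
    congr 1
    rw [← mul_one_add c (s.card : ℂ), add_comm (1 : ℂ), inv_mul_cancel₀ hc, one_smul]
  have hnorm : ‖(f : H →L[ℂ] H)‖ ≤ 1 := by
    rw [hfc]
    have h2 : ‖(1 : H →L[ℂ] H) + ∑ P ∈ s, (1 - P)‖ ≤ s.card + 1 := by
      refine (norm_add_le _ _).trans ?_
      have h3 : ‖∑ P ∈ s, ((1 : H →L[ℂ] H) - P)‖ ≤ s.card := by
        refine (norm_sum_le _ _).trans ?_
        rw [← nsmul_one]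
        exact Finset.sum_le_card_nsmul _ _ _ fun P hP => (hs P hP).1.one_sub.norm_le
      have h4 : ‖(1 : H →L[ℂ] H)‖ ≤ 1 := ContinuousLinearMap.norm_id_le
      linarith
    have h5 : ‖c‖ = ((s.card : ℝ) + 1)⁻¹ := by
      rw [norm_inv]
      congr 1
      exact_mod_cast Complex.norm_natCast (s.card + 1)
    refine (norm_smul_le _ _).trans ?_
    rw [h5, inv_mul_le_iff₀ (by positivity)]
    simpa using h2
  have hfφ : ∀ n : ℕ, (φ.toStarAlgHom (f ^ n) : K →L[ℂ] K) v = v := by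
    have h2 : (φ.toStarAlgHom f : K →L[ℂ] K) v = v := by
      have h3 : (φ.toStarAlgHom T : K →L[ℂ] K) v = 0 := by
        simp only [T, map_sum, AddSubmonoidClass.coe_finsetSum, sum_apply]
        exact Finset.sum_eq_zero fun P _ => hv P.1 P.2
      simp [f, map_sub, map_smul, h3]
    intro n
    induction n with
    | zero => simp
    | succ n ih =>
      rw [pow_succ, map_mul]
      change (φ.toStarAlgHom (f ^ n) : K →L[ℂ] K) ((φ.toStarAlgHom f : K →L[ℂ] K) v) = v
      rw [h2, ih]
  have hpow : ∀ k : ℕ, ‖(f : H →L[ℂ] H) ^ k‖ ≤ 1 := fun k => by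
    induction k with
    | zero => exact ContinuousLinearMap.norm_id_le
    | succ k ih =>
      rw [pow_succ]
      exact (norm_mul_le _ _).trans (mul_le_one₀ ih (norm_nonneg _) hnorm)
  let B : ℕ → M.toStarSubalgebra := fun n =>
    ((n + 1 : ℕ) : ℂ)⁻¹ • ∑ k ∈ Finset.range (n + 1), f ^ k
  have hB : ∀ n, (B n : H →L[ℂ] H)
      = ((n + 1 : ℕ) : ℂ)⁻¹ • ∑ k ∈ Finset.range (n + 1), (f : H →L[ℂ] H) ^ k := fun n => by
    simp [B]
  refine φ.apply_eq_of_tendsto (l := atTop) (f := B) (C := 1) (fun n => ?_) (fun x => ?_)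
    (fun n => ?_)
  · rw [hB]
    refine (norm_smul_le _ _).trans ?_
    rw [norm_inv, Complex.norm_natCast, inv_mul_le_iff₀ (by positivity), mul_one]
    refine (norm_sum_le _ _).trans ?_
    exact (Finset.sum_le_card_nsmul _ _ 1 fun k _ => hpow k).trans (by simp)
  · have hlim := ((f : H →L[ℂ] H).tendsto_birkhoffAverage_orthogonalProjection hnorm x).comp
      (tendsto_add_atTop_nat 1)
    have hfix : ((f : H →L[ℂ] H)).eqLocus (1 : H →L[ℂ] H)
        = (⨆ P ∈ (s : Set (H →L[ℂ] H)), LinearMap.range P.toLinearMap)ᗮ := by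
      ext y
      have h2 : y ∈ ((f : H →L[ℂ] H)).eqLocus (1 : H →L[ℂ] H) ↔ ∀ P ∈ s, P y = 0 := by
        rw [← sum_apply_eq_zero_iff (fun P hP => (hs P hP).1)]
        change (f : H →L[ℂ] H) y = y ↔ _
        rw [hfv]
        simp [c, hc]
      rw [h2, Submodule.mem_orthogonal']
      constructor
      · intro h u hu
        have h3 : (⨆ P ∈ (s : Set (H →L[ℂ] H)), LinearMap.range P.toLinearMap)
            ≤ (Submodule.span ℂ {y})ᗮ := by
          refine iSup₂_le fun P hP => ?_
          rintro _ ⟨z, rfl⟩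
          rw [Submodule.mem_orthogonal_singleton_iff_inner_right]
          have h4 := (hs P hP).1.isSelfAdjoint.isSymmetric y z
          simp only [ContinuousLinearMap.coe_coe] at h4 ⊢
          rw [← h4, h P hP, inner_zero_left]
        exact Submodule.mem_orthogonal_singleton_iff_inner_right.mp (h3 hu)
      · intro h P hP
        have h4 := (hs P hP).1.isSelfAdjoint.isSymmetric y (P y)
        simp only [ContinuousLinearMap.coe_coe] at h4
        rw [← inner_self_eq_zero (𝕜 := ℂ), h4]
        exact h _ (Submodule.mem_iSup_of_mem P (Submodule.mem_iSup_of_mem hP ⟨_, rfl⟩))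
    change Tendsto (fun n => (B n : H →L[ℂ] H) x) atTop
      (𝓝 ((1 - projSup (s : Set (H →L[ℂ] H))) x))
    rw [projSup_eq_one_sub_starProjection]
    simp only [← hfix]
    refine hlim.congr fun n => ?_
    rw [hB]
    simp [birkhoffAverage, birkhoffSum, sum_apply]
  · simp only [B, map_smul, map_sum]
    have h2 : ((∑ k ∈ Finset.range (n + 1), φ.toStarAlgHom (f ^ k) : N.toStarSubalgebra)
        : K →L[ℂ] K) v = ((n + 1 : ℕ) : ℂ) • v := by
      rw [AddSubmonoidClass.coe_finsetSum, sum_apply, Finset.sum_congr rfl fun k _ => hfφ k]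
      rw [Finset.sum_const, Finset.card_range, Nat.cast_smul_eq_nsmul]
    change ((n + 1 : ℕ) : ℂ)⁻¹ • ((∑ k ∈ Finset.range (n + 1), φ.toStarAlgHom (f ^ k) :
      N.toStarSubalgebra) : K →L[ℂ] K) v = v
    rw [h2, inv_smul_smul₀ (Nat.cast_ne_zero.mpr (Nat.succ_ne_zero n))]

/-- A quantum function maps covers to covers. -/
theorem QuantumFunction.eq_zero_of_projSup_eq_one (φ : QuantumFunction M N)
    {S : Set (H →L[ℂ] H)} (hS : ∀ P ∈ S, IsProjIn M P) (h1 : projSup S = 1) {v : K}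
    (hv : ∀ P (hP : P ∈ S), (φ.toStarAlgHom ⟨P, (hS P hP).2⟩ : K →L[ℂ] K) v = 0) : v = 0 := by
  classical
  let t : Finset S → Finset (H →L[ℂ] H) := fun s => s.map (Function.Embedding.subtype _)
  have ht : ∀ s, ∀ P ∈ t s, P ∈ S := fun s P hP => by
    obtain ⟨Q, -, rfl⟩ := Finset.mem_map.mp hP
    exact Q.2
  have hmem : ∀ s, IsProjIn M (projSup (t s : Set (H →L[ℂ] H))) := fun s =>
    isProjIn_projSup fun P hP => (hS P (ht s P hP)).2
  let f : Finset S → M.toStarSubalgebra := fun s =>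
    ⟨1 - projSup (t s : Set (H →L[ℂ] H)), sub_mem (one_mem M.toStarSubalgebra) (hmem s).2⟩
  -- The complements of finite joins decrease strongly to zero, while each of their images fixes
  -- `v`; hence `φ 0` fixes `v`.
  have key : (φ.toStarAlgHom (0 : M.toStarSubalgebra) : K →L[ℂ] K) v = v := by
    refine φ.apply_eq_of_tendsto (l := atTop) (f := f) (C := 1) (fun s => ?_) (fun x => ?_)
      (fun s => ?_)
    · exact (hmem s).1.one_sub.norm_le
    · let U : Finset S → Submodule ℂ H := fun s =>
        (⨆ P ∈ (t s : Set (H →L[ℂ] H)), LinearMap.range P.toLinearMap).topologicalClosure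
      have hmono : Monotone U := fun s s' hss' => Submodule.topologicalClosure_mono
        (biSup_mono fun P hP => Finset.map_subset_map.mpr hss' hP)
      have hdense : ⊤ ≤ (⨆ s, U s).topologicalClosure := by
        have h2 : (⨆ P ∈ S, LinearMap.range P.toLinearMap).topologicalClosure = ⊤ := by
          refine eq_top_iff.mpr fun x _ => ?_
          have h3 : projSup S x = x := by rw [h1]; rfl
          rw [← h3]
          exact Submodule.starProjection_apply_mem _ x
        rw [← h2]
        refine Submodule.topologicalClosure_mono (iSup₂_le fun P hP => ?_)
        refine le_iSup_of_le {⟨P, hP⟩} (le_trans ?_ (Submodule.le_topologicalClosure _))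
        exact le_iSup₂_of_le P (by simp [t]) le_rfl
      have h4 := (Submodule.starProjection_tendsto_self U hmono x hdense).const_sub x
      rw [sub_self] at h4
      exact h4
    · exact φ.apply_one_sub_projSup_eq (fun P hP => hS P (ht s P hP))
        (fun P hP => hv P (ht s P hP)) _
  rw [map_zero] at key
  exact key.symm

end Normality

/-! ### Neighborhoods when `M` is all of `B(H)` -/

namespace QuantumMetric

open InnerProductSpace

variable {H : Type*} [NormedAddCommGroup H] [InnerProductSpace ℂ H] [CompleteSpace H]
  {M : VonNeumannAlgebra H} (𝕍 : QuantumMetric M)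

/-- A triangle inequality: for `A` of displacement `t < s`, the range projection of `A * Z` is at
distance at least `r` from `Y`, so the neighborhood of `Y` annihilates it. That range projection
must belong to `M`, hence `hM`. -/
theorem le_dist_nhd (hM : ∀ A, A ∈ M) {Y Z : H →L[ℂ] H} {r s : ℝ≥0}
    (h : ((s + r : ℝ≥0) : ℝ≥0∞) ≤ 𝕍.dist Y Z) : (s : ℝ≥0∞) ≤ 𝕍.dist (𝕍.nhd Y r) Z := by
  rw [le_dist_iff] at h ⊢
  intro t ht A hA
  obtain ⟨R, hR, hRX⟩ := exists_isStarProjection_mul_eq_zero_iff (A * Z)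
  rw [mul_assoc, ← hRX]
  refine 𝕍.nhd_mul_eq_zero ⟨hR, hM R⟩ (𝕍.le_dist_iff.mpr fun u hu B hB => ?_)
  rw [hRX, ← mul_assoc, mul_assoc Y]
  refine h (u + t) ?_ _ (𝕍.mul_mem' u t B hB A hA)
  rw [add_comm s]
  exact add_lt_add hu ht

/-- Each neighborhood uses up `r` of the distance, and the last one turns the remaining `r` into
orthogonality. At least one step is needed, as distance zero carries no information. -/
theorem iterate_nhd_mul_eq_zero (hM : ∀ A, A ∈ M) {Z : H →L[ℂ] H} (hZ : IsStarProjection Z)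
    (r : ℝ≥0) (m : ℕ) {X : H →L[ℂ] H}
    (h : (((m + 1 : ℕ) * r : ℝ≥0) : ℝ≥0∞) ≤ 𝕍.dist X Z) :
    (fun Y => 𝕍.nhd Y r)^[m + 1] X * Z = 0 := by
  induction m generalizing X with
  | zero => exact 𝕍.nhd_mul_eq_zero ⟨hZ, hM Z⟩ (by simpa using h)
  | succ m ih =>
    rw [Function.iterate_succ_apply]
    refine ih (𝕍.le_dist_nhd hM (le_of_eq_of_le ?_ h))
    congr 1
    push_cast
    ring

theorem isStarProjection_iterate_nhd (r : ℝ≥0) (m : ℕ) (X : H →L[ℂ] H) :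
    IsStarProjection ((fun Y => 𝕍.nhd Y r)^[m + 1] X) := by
  rw [Function.iterate_succ_apply']
  exact (𝕍.isProjIn_nhd _ r).1

/-- In a full matrix algebra, the neighborhood of `Y` is a combination of operators `B * Y * C` with
`B` of displacement less than `r`. -/
theorem nhd_mem_span [FiniteDimensional ℂ H] (hM : ∀ A, A ∈ M) {Y : H →L[ℂ] H}
    (hY : IsStarProjection Y) (r : ℝ≥0) :
    𝕍.nhd Y r ∈ Submodule.span ℂ {X | ∃ u < r, ∃ B ∈ 𝕍.V u, ∃ C, X = B * Y * C} := by
  set I := Submodule.span ℂ {X | ∃ u < r, ∃ B ∈ 𝕍.V u, ∃ C, X = B * Y * C} with hI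
  let W : Submodule ℂ H := Submodule.span ℂ {w | ∃ u < r, ∃ B ∈ 𝕍.V u, ∃ x, w = B (Y x)}
  have hWI : ∀ w ∈ W, ∀ z, rankOne ℂ w z ∈ I := by
    intro w hw z
    induction hw using Submodule.span_induction with
    | zero => simp
    | add x y _ _ hx hy => simpa using add_mem hx hy
    | smul c x _ hx => simpa using I.smul_mem c hx
    | mem w hw =>
      obtain ⟨u, hu, B, hB, x, rfl⟩ := hw
      refine Submodule.subset_span ⟨u, hu, B, hB, rankOne ℂ x z, ?_⟩
      ext y
      simp
  -- Every `B * Y` with `B` of displacement below `r` maps into `W`, so by taking adjoints the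
  -- complement of `W` is at distance at least `r` from `Y`.
  have hz : 𝕍.nhd Y r * Wᗮ.starProjection = 0 := by
    refine 𝕍.nhd_mul_eq_zero ⟨isStarProjection_starProjection, hM _⟩
      (𝕍.le_dist_iff.mpr fun u hu B hB => ?_)
    rw [← star_eq_zero, star_mul, star_mul, hY.isSelfAdjoint.star_eq,
      isStarProjection_starProjection.isSelfAdjoint.star_eq]
    ext x
    refine (Submodule.starProjection_apply_eq_zero_iff _).mpr ?_
    exact Submodule.le_orthogonal_orthogonal W
      (Submodule.subset_span ⟨u, hu, star B, 𝕍.star_mem' u B hB, x, rfl⟩)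
  have hrange : ∀ x, 𝕍.nhd Y r x ∈ W := fun x => by
    have hz' : Wᗮ.starProjection * 𝕍.nhd Y r = 0 := by
      rw [← star_eq_zero, star_mul, (𝕍.isProjIn_nhd Y r).1.isSelfAdjoint.star_eq,
        isStarProjection_starProjection.isSelfAdjoint.star_eq, hz]
    have h1 := (Submodule.starProjection_apply_eq_zero_iff _).mp
      (congrArg (fun T : H →L[ℂ] H => T x) hz')
    rwa [Submodule.orthogonal_orthogonal] at h1
  have hsum : 𝕍.nhd Y r = ∑ i, rankOne ℂ (𝕍.nhd Y r (stdOrthonormalBasis ℂ H i))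
      (stdOrthonormalBasis ℂ H i) := by
    ext x
    conv_lhs => rw [← (stdOrthonormalBasis ℂ H).sum_repr' x]
    simp [sum_apply]
  rw [hsum]
  exact I.sum_mem fun i _ => hWI _ (hrange _) _

/-- Expanding both copies of the neighborhood by `nhd_mem_span` shows that two projections linked
through it are linked through some `B₁ * (Y * D * Y) * B₂` with each `Bᵢ` of displacement below `r`.
Absorbing `B₁` and `B₂` into the two projections links them through `Y`, and undoing this costs less
than `r` on each side. -/
theorem diam_nhd_le [FiniteDimensional ℂ H] (hM : ∀ A, A ∈ M) {Y : H →L[ℂ] H}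
    (hY : IsStarProjection Y) (r : ℝ≥0) : 𝕍.diam (𝕍.nhd Y r) ≤ 𝕍.diam Y + 2 * r := by
  refine iSup_le fun Q => iSup_le fun R => iSup_le fun hQ => iSup_le fun hR => iSup_le ?_
  rintro ⟨A, hA⟩
  obtain ⟨u₁, hu₁, B₁, hB₁, u₂, hu₂, B₂, hB₂, D, hD⟩ : ∃ u₁ < r, ∃ B₁ ∈ 𝕍.V u₁, ∃ u₂ < r,
      ∃ B₂ ∈ 𝕍.V u₂, ∃ D, Q * opTensor (B₁ * (Y * D * Y) * B₂) 1 * R ≠ 0 := by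
    by_contra! hcon
    apply hA
    have key : ∀ X₁ ∈ Submodule.span ℂ {X | ∃ u < r, ∃ B ∈ 𝕍.V u, ∃ C, X = B * Y * C},
        ∀ X₂ ∈ Submodule.span ℂ {X | ∃ u < r, ∃ B ∈ 𝕍.V u, ∃ C, X = B * Y * C},
        Q * opTensor (X₁ * A * star X₂) 1 * R = 0 := by
      intro X₁ h₁ X₂ h₂
      induction h₁ using Submodule.span_induction with
      | zero => simp [opTensor_zero_one]
      | add X X' _ _ hX hX' =>
        rw [add_mul, add_mul, opTensor_add_one, mul_add, add_mul, hX, hX', add_zero]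
      | smul c X _ hX =>
        rw [smul_mul_assoc, smul_mul_assoc, opTensor_smul_one, mul_smul_comm, smul_mul_assoc, hX,
          smul_zero]
      | mem X hX =>
        obtain ⟨u₁, hu₁, B₁, hB₁, C₁, rfl⟩ := hX
        induction h₂ using Submodule.span_induction with
        | zero => simp [opTensor_zero_one]
        | add X X' _ _ hX hX' =>
          rw [star_add, mul_add, opTensor_add_one, mul_add, add_mul, hX, hX', add_zero]
        | smul c X _ hX =>
          rw [star_smul, mul_smul_comm, opTensor_smul_one, mul_smul_comm, smul_mul_assoc, hX,
            smul_zero]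
        | mem X hX =>
          obtain ⟨u₂, hu₂, B₂, hB₂, C₂, rfl⟩ := hX
          have h := hcon u₁ hu₁ B₁ hB₁ u₂ hu₂ (star B₂) (𝕍.star_mem' u₂ B₂ hB₂) (C₁ * A * star C₂)
          rw [star_mul, star_mul, hY.isSelfAdjoint.star_eq]
          simpa only [mul_assoc] using h
    have h := key _ (𝕍.nhd_mem_span hM hY r) _ (𝕍.nhd_mem_span hM hY r)
    rwa [(𝕍.isProjIn_nhd Y r).1.isSelfAdjoint.star_eq] at h
  -- These supports need only be projections on the amplified space: all of them belong to the
  -- amplification by `mem_ampAlgebra_of_forall_mem`.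
  obtain ⟨Q', hQ', hQX⟩ := exists_isStarProjection_mul_eq_zero_iff' (Q * opTensor B₁ 1)
  obtain ⟨R', hR', hRX⟩ := exists_isStarProjection_mul_eq_zero_iff (opTensor B₂ 1 * R)
  have hiff : ∀ T : H →L[ℂ] H, Q' * opTensor T 1 * R' = 0 ↔
      Q * opTensor (B₁ * T * B₂) 1 * R = 0 := fun T => by
    rw [mul_assoc, hQX, ← mul_assoc, hRX, opTensor_mul_one, opTensor_mul_one]
    simp only [mul_assoc]
  have hle : 𝕍.ampDist Q' R' ≤ 𝕍.diam Y :=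
    le_iSup_of_le Q' <| le_iSup_of_le R' <| le_iSup_of_le ⟨hQ', mem_ampAlgebra_of_forall_mem hM _⟩ <|
      le_iSup_of_le ⟨hR', mem_ampAlgebra_of_forall_mem hM _⟩ <|
        le_iSup_of_le ⟨D, (hiff _).not.mpr hD⟩ le_rfl
  refine le_trans ?_ (add_le_add_left hle _)
  rw [ampDist, ampDist, ENNReal.iInf_add]
  refine le_iInf fun t => ?_
  rw [ENNReal.iInf_add]
  refine le_iInf ?_
  rintro ⟨C, hC, hne⟩
  refine iInf_le_of_le (u₁ + t + u₂) (iInf_le_of_le ⟨B₁ * C * B₂,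
    𝕍.mul_mem' _ _ _ (𝕍.mul_mem' _ _ _ hB₁ _ hC) _ hB₂, (hiff C).not.mp hne⟩ ?_)
  have h : u₁ + t + u₂ ≤ t + 2 * r := by
    rw [two_mul, ← add_assoc, add_comm u₁ t]
    gcongr
  exact_mod_cast h

theorem diam_iterate_nhd_le [FiniteDimensional ℂ H] (hM : ∀ A, A ∈ M) {Y : H →L[ℂ] H}
    (hY : IsStarProjection Y) (r : ℝ≥0) (m : ℕ) :
    IsStarProjection ((fun Y => 𝕍.nhd Y r)^[m] Y) ∧
      𝕍.diam ((fun Y => 𝕍.nhd Y r)^[m] Y) ≤ 𝕍.diam Y + m * (2 * r) := by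
  induction m with
  | zero => simpa using hY
  | succ m ih =>
    rw [Function.iterate_succ_apply']
    refine ⟨(𝕍.isProjIn_nhd _ r).1, (𝕍.diam_nhd_le hM ih.1 r).trans ?_⟩
    refine (add_le_add_left ih.2 _).trans (le_of_eq ?_)
    push_cast
    ring

end QuantumMetric

/-! ### Rank counting in matrix algebras -/

section Rank

variable {n : ℕ}

theorem mem_matrixAlgebra (A : EuclideanSpace ℂ (Fin n) →L[ℂ] EuclideanSpace ℂ (Fin n)) :
    A ∈ matrixAlgebra n :=
  Set.mem_univ A

/-- Iterating an isoperimetric inequality. -/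
theorem IsoperimetricInequality.pow_mul_rank_le {𝕍 : QuantumMetric (matrixAlgebra n)}
    {δ ε t d : ℝ≥0} (h : IsoperimetricInequality 𝕍 δ ε t)
    {X : EuclideanSpace ℂ (Fin n) →L[ℂ] EuclideanSpace ℂ (Fin n)} (hX : IsStarProjection X)
    (hd : 𝕍.diam X ≤ d) (m : ℕ) (hm : d + m * (2 * δ) ≤ t) :
    (1 + (ε : ℝ)) ^ m * (rank X : ℝ) ≤ rank ((fun Y => 𝕍.nhd Y δ)^[m] X) := by
  induction m with
  | zero => simp
  | succ m ih =>
    have hm' : d + m * (2 * δ) ≤ t := by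
      refine le_trans ?_ hm
      gcongr
      exact Nat.le_succ m
    obtain ⟨h1, h2⟩ := 𝕍.diam_iterate_nhd_le mem_matrixAlgebra hX δ m
    have h3 : 𝕍.diam ((fun Y => 𝕍.nhd Y δ)^[m] X) ≤ t := by
      refine h2.trans ((add_le_add_left hd _).trans ?_)
      exact_mod_cast hm'
    rw [Function.iterate_succ_apply', pow_succ', mul_assoc]
    exact (mul_le_mul_of_nonneg_left (ih hm') (by positivity)).trans
      (h _ ⟨h1, mem_matrixAlgebra _⟩ h3)

/-- The ranges are mutually orthogonal subspaces of an `n`-dimensional space, so their dimensions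
add up. -/
theorem sum_rank_le_of_mul_eq_zero {ι : Type*} (s : Finset ι)
    (N : ι → EuclideanSpace ℂ (Fin n) →L[ℂ] EuclideanSpace ℂ (Fin n))
    (hN : ∀ i ∈ s, IsStarProjection (N i))
    (h : ∀ i ∈ s, ∀ j ∈ s, i ≠ j → N i * N j = 0) : ∑ i ∈ s, rank (N i) ≤ n := by
  classical
  suffices hs : ∑ i ∈ s, rank (N i)
      ≤ Module.finrank ℂ (⨆ i ∈ s, LinearMap.range (N i).toLinearMap : Submodule ℂ _) by
    refine hs.trans ((Submodule.finrank_le _).trans ?_)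
    simp
  induction s using Finset.induction_on with
  | empty => simp
  | insert a s ha ih =>
    rw [Finset.sum_insert ha, Finset.iSup_insert]
    have hdis : LinearMap.range (N a).toLinearMap
        ⊓ (⨆ i ∈ s, LinearMap.range (N i).toLinearMap) = ⊥ := by
      refine (Submodule.IsOrtho.disjoint ?_).eq_bot
      simp only [Submodule.isOrtho_iSup_right]
      intro i hi
      rw [Submodule.isOrtho_iff_inner_eq]
      rintro _ ⟨x, rfl⟩ _ ⟨y, rfl⟩
      have h1 := (hN a (Finset.mem_insert_self a s)).isSelfAdjoint.isSymmetric x (N i y)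
      have h2 := h a (Finset.mem_insert_self a s) i (Finset.mem_insert_of_mem hi)
        (fun hai => ha (hai ▸ hi))
      have h3 : N a (N i y) = 0 := congrArg
        (fun T : EuclideanSpace ℂ (Fin n) →L[ℂ] EuclideanSpace ℂ (Fin n) => T y) h2
      simpa [h3] using h1
    have h4 := Submodule.finrank_sup_add_finrank_inf_eq (LinearMap.range (N a).toLinearMap)
      (⨆ i ∈ s, LinearMap.range (N i).toLinearMap)
    rw [hdis, finrank_bot, add_zero] at h4
    rw [h4]
    exact add_le_add_right (ih (fun i hi => hN i (Finset.mem_insert_of_mem hi))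
      fun i hi j hj => h i (Finset.mem_insert_of_mem hi) j (Finset.mem_insert_of_mem hj)) _

theorem finrank_iSup_le_sum_rank {ι : Type*} (s : Finset ι)
    (N : ι → EuclideanSpace ℂ (Fin n) →L[ℂ] EuclideanSpace ℂ (Fin n)) :
    Module.finrank ℂ (⨆ i ∈ s, LinearMap.range (N i).toLinearMap : Submodule ℂ _)
      ≤ ∑ i ∈ s, rank (N i) := by
  classical
  induction s using Finset.induction_on with
  | empty => simp
  | insert a s ha ih =>
    rw [Finset.sum_insert ha, Finset.iSup_insert]
    exact (Submodule.finrank_add_le_finrank_add_finrank _ _).trans (add_le_add_right ih _)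

/-- If self-adjoint operators have trivial common kernel, then the ranks of finitely many of them sum
up to the dimension at least. -/
theorem exists_finset_le_sum_rank {ι : Type*} (S : Set ι)
    (N : ι → EuclideanSpace ℂ (Fin n) →L[ℂ] EuclideanSpace ℂ (Fin n))
    (hN : ∀ i ∈ S, IsSelfAdjoint (N i)) (h : ∀ v, (∀ i ∈ S, N i v = 0) → v = 0) :
    ∃ G : Finset ι, (G : Set ι) ⊆ S ∧ n ≤ ∑ i ∈ G, rank (N i) := by
  classical
  have htop : (⨆ i ∈ S, LinearMap.range (N i).toLinearMap) = ⊤ := by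
    rw [← Submodule.orthogonal_eq_bot_iff, eq_bot_iff]
    intro v hv
    refine h v fun i hi => ?_
    have h1 := (hN i hi).isSymmetric (N i v) v
    have h2 : inner ℂ (N i (N i v)) v = 0 := Submodule.mem_orthogonal _ _ |>.mp hv _
      (Submodule.mem_iSup_of_mem i (Submodule.mem_iSup_of_mem hi ⟨_, rfl⟩))
    simp only [ContinuousLinearMap.coe_coe, h2] at h1
    exact inner_self_eq_zero.mp h1.symm
  -- Subspaces of a finite-dimensional space satisfy the ascending chain condition, so finitely many
  -- of the ranges already span.
  obtain ⟨t, htS, ht⟩ := CompleteLattice.WellFoundedGT.isSupFiniteCompact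
    (Submodule ℂ (EuclideanSpace ℂ (Fin n))) ((fun i => LinearMap.range (N i).toLinearMap) '' S)
  obtain ⟨G, hGS, rfl⟩ := Finset.subset_set_image_iff.mp htS
  refine ⟨G, hGS, ?_⟩
  refine le_trans (le_of_eq ?_) (finrank_iSup_le_sum_rank G N)
  rw [sSup_image, htop, Finset.sup_image, Finset.sup_eq_iSup] at ht
  have h2 : (⨆ i ∈ G, LinearMap.range (N i).toLinearMap) = ⊤ := ht.symm
  rw [h2, finrank_top]
  simp

end Rank

/-! ### Carrying disjointness through a quantum function -/

section Transport

variable {H : Type*} [NormedAddCommGroup H] [InnerProductSpace ℂ H] [CompleteSpace H]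
  {K : Type*} [NormedAddCommGroup K] [InnerProductSpace ℂ K] [CompleteSpace K]
  {M : VonNeumannAlgebra H} {N : VonNeumannAlgebra K}

theorem isStarProjection_coe_iff {P : M.toStarSubalgebra} :
    IsStarProjection (P : H →L[ℂ] H) ↔ IsStarProjection P := by
  simp only [isStarProjection_iff, IsIdempotentElem, IsSelfAdjoint, Subtype.ext_iff,
    MulMemClass.coe_mul, StarMemClass.coe_star]

theorem QuantumFunction.isStarProjection_apply (φ : QuantumFunction M N) {P : M.toStarSubalgebra}
    (hP : IsStarProjection (P : H →L[ℂ] H)) :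
    IsStarProjection (φ.toStarAlgHom P : K →L[ℂ] K) :=
  isStarProjection_coe_iff.mpr ((isStarProjection_coe_iff.mp hP).map φ.toStarAlgHom)

/-- If `φ` distorts distances little enough, then it maps projections with disjoint neighborhoods to
projections whose iterated neighborhoods are disjoint. -/
theorem QuantumFunction.iterate_nhd_mul_eq_zero (𝕍 : QuantumMetric M) (𝕎 : QuantumMetric N)
    (φ : QuantumFunction M N) (hN : ∀ A, A ∈ N) {r δ : ℝ≥0} {m : ℕ}
    (hr : (((m + 1 : ℕ) * δ : ℝ≥0) : ℝ≥0∞) ≤ φ.omegaTilde 𝕍 𝕎 r) {P Q : M.toStarSubalgebra}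
    (hP : IsStarProjection (P : H →L[ℂ] H)) (hQ : IsStarProjection (Q : H →L[ℂ] H))
    (hPQ : 𝕍.nhd P r * 𝕍.nhd Q r = 0) :
    (fun Y => 𝕎.nhd Y δ)^[m + 1] (φ.toStarAlgHom P : K →L[ℂ] K)
      * (fun Y => 𝕎.nhd Y δ)^[m + 1] (φ.toStarAlgHom Q : K →L[ℂ] K) = 0 := by
  let E : M.toStarSubalgebra → M.toStarSubalgebra := fun P => ⟨𝕍.nhd P r, (𝕍.isProjIn_nhd P r).2⟩
  -- The iterated neighborhood of `φ P` lies under `φ (E P)`: `P` is at distance at least `r` from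
  -- `1 - E P`, so their images are at least `(m + 1) * δ` apart.
  have hE : ∀ P : M.toStarSubalgebra, IsStarProjection (P : H →L[ℂ] H) →
      (fun Y => 𝕎.nhd Y δ)^[m + 1] (φ.toStarAlgHom P : K →L[ℂ] K)
        * (φ.toStarAlgHom (E P) : K →L[ℂ] K)
        = (fun Y => 𝕎.nhd Y δ)^[m + 1] (φ.toStarAlgHom P : K →L[ℂ] K) := by
    intro P hP
    have hE1 : IsStarProjection ((1 - E P : M.toStarSubalgebra) : H →L[ℂ] H) :=
      (𝕍.isProjIn_nhd P r).1.one_sub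
    have h1 : φ.omegaTilde 𝕍 𝕎 r
        ≤ 𝕎.dist (φ.toStarAlgHom P) (φ.toStarAlgHom (1 - E P)) :=
      iInf_le_of_le P <| iInf_le_of_le (1 - E P) <| iInf_le_of_le (isStarProjection_coe_iff.mp hP) <|
        iInf_le_of_le (isStarProjection_coe_iff.mp hE1) <|
          iInf_le_of_le (𝕍.le_dist_one_sub_nhd P r) le_rfl
    have h2 := 𝕎.iterate_nhd_mul_eq_zero hN (φ.isStarProjection_apply hE1) δ m (hr.trans h1)
    rw [map_sub, map_one] at h2
    change _ * (1 - (φ.toStarAlgHom (E P) : K →L[ℂ] K)) = 0 at h2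
    rw [mul_sub, mul_one, sub_eq_zero] at h2
    exact h2.symm
  have hstar : (φ.toStarAlgHom (E Q) : K →L[ℂ] K)
        * (fun Y => 𝕎.nhd Y δ)^[m + 1] (φ.toStarAlgHom Q : K →L[ℂ] K)
        = (fun Y => 𝕎.nhd Y δ)^[m + 1] (φ.toStarAlgHom Q : K →L[ℂ] K) := by
    have h := congrArg star (hE Q hQ)
    rwa [star_mul, (𝕎.isStarProjection_iterate_nhd δ m _).isSelfAdjoint.star_eq,
      (φ.isStarProjection_apply (P := E Q) (𝕍.isProjIn_nhd Q r).1).isSelfAdjoint.star_eq] at h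
  have hEE : (φ.toStarAlgHom (E P) : K →L[ℂ] K) * (φ.toStarAlgHom (E Q) : K →L[ℂ] K) = 0 := by
    have h1 : E P * E Q = 0 := Subtype.ext hPQ
    have h2 := congrArg φ.toStarAlgHom h1
    rw [map_mul, map_zero] at h2
    exact congrArg Subtype.val h2
  rw [← hE P hP, ← hstar, mul_assoc, ← mul_assoc (φ.toStarAlgHom (E P) : K →L[ℂ] K), hEE, zero_mul,
    mul_zero]

end Transport

/-! ### The counting argument -/

/-- A quantum metric space that embeds equi-coarsely into matrix algebras satisfying isoperimetric
inequalities at all scales has infinite asymptotic dimension. -/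
theorem asdim_eq_top_of_isEquiCoarse {H : Type*} [NormedAddCommGroup H] [InnerProductSpace ℂ H]
    [CompleteSpace H] {M : VonNeumannAlgebra H} {𝕍 : QuantumMetric M}
    {δ ε : ℝ≥0} (hδ : 0 < δ) (hε : 0 < ε) {n : {t : ℝ≥0 // 0 < t} → ℕ} (hn : ∀ t, 1 ≤ n t)
    {𝕎 : ∀ t, QuantumMetric (matrixAlgebra (n t))}
    {φ : ∀ t, QuantumFunction M (matrixAlgebra (n t))} (hequi : IsEquiCoarse 𝕍 𝕎 φ)
    (hiso : ∀ t, IsoperimetricInequality (𝕎 t) δ ε t) : 𝕍.asdim = ⊤ := by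
  classical
  simp only [QuantumMetric.asdim, iInf_eq_top]
  intro k hk
  exfalso
  obtain ⟨f, g, hf, hg, hfg⟩ := hequi
  obtain ⟨m, hm⟩ := pow_unbounded_of_one_lt ((k : ℝ) + 1)
    (show (1 : ℝ) < 1 + (ε : ℝ) by simpa using hε)
  -- The exponent is raised to `m + 1` because orthogonality of iterated neighborhoods requires at
  -- least one iteration.
  have hm1 : (k : ℝ) + 1 < (1 + (ε : ℝ)) ^ (m + 1) :=
    hm.trans_le (pow_le_pow_right₀ (by simp) (Nat.le_succ m))
  obtain ⟨r, hfr, hr⟩ := ((hf.eventually (lt_mem_nhds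
    (ENNReal.coe_lt_top (r := ((m + 1 : ℕ) * δ : ℝ≥0))))).and
      (Filter.eventually_gt_atTop 0)).exists
  obtain ⟨F, hF, hcover⟩ := hk r hr
  choose R hR using fun i => (hF i).2.1
  -- The sum of the `R i` bounds the diameters in all `k + 1` families at once. Since `g` does not
  -- depend on `t`, `d` can be fixed first and `t` chosen to leave room for `m + 1` enlargements by
  -- `2δ`.
  let d : ℝ≥0 := (g (∑ i, R i)).toNNReal
  let t : {t : ℝ≥0 // 0 < t} := ⟨d + (m + 1 : ℕ) * (2 * δ), by positivity⟩
  have hS : ∀ P ∈ ⋃ i, F i, IsProjIn M P := fun P hP => by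
    obtain ⟨i, hi⟩ := Set.mem_iUnion.mp hP
    exact (hF i).1 P hi
  -- A total version of `φ t`; the value `0` outside `M` is never met on the cover.
  let ψ : (H →L[ℂ] H) → EuclideanSpace ℂ (Fin (n t)) →L[ℂ] EuclideanSpace ℂ (Fin (n t)) := fun P =>
    if hP : P ∈ M.toStarSubalgebra then ((φ t).toStarAlgHom ⟨P, hP⟩).1 else 0
  have hψ : ∀ P (hP : P ∈ M.toStarSubalgebra), ψ P = ((φ t).toStarAlgHom ⟨P, hP⟩).1 :=
    fun P hP => dif_pos hP
  have hψproj : ∀ P ∈ ⋃ i, F i, IsStarProjection (ψ P) := fun P hP => by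
    rw [hψ P (hS P hP).2]
    exact (φ t).isStarProjection_apply (hS P hP).1
  obtain ⟨G, hGS, hG⟩ := exists_finset_le_sum_rank (⋃ i, F i) ψ
    (fun P hP => (hψproj P hP).isSelfAdjoint) fun v hv =>
      (φ t).eq_zero_of_projSup_eq_one hS hcover fun P hP => by
        rw [← hψ P (hS P hP).2]
        exact hv P hP
  have hrank : ∀ P ∈ G, (1 + (ε : ℝ)) ^ (m + 1) * (rank (ψ P) : ℝ)
      ≤ rank ((fun Y => (𝕎 t).nhd Y δ)^[m + 1] (ψ P)) := fun P hP => by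
    have hP' := hGS hP
    refine (hiso t).pow_mul_rank_le (d := d) (hψproj P hP') ?_ (m + 1) le_rfl
    obtain ⟨i, hi⟩ := Set.mem_iUnion.mp hP'
    have h1 : 𝕍.diam P ≤ (∑ i, R i : ℝ≥0) := ((hR i).2 P hi).trans
      (ENNReal.coe_le_coe.mpr (Finset.single_le_sum (fun j _ => zero_le) (Finset.mem_univ i)))
    have h2 : (𝕎 t).diam (ψ P) ≤ (φ t).rhoTilde 𝕍 (𝕎 t) (∑ i, R i) := by
      rw [hψ P (hS P hP').2]
      exact le_iSup_of_le ⟨P, (hS P hP').2⟩ <|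
        le_iSup_of_le (isStarProjection_coe_iff.mp (hS P hP').1) <| le_iSup_of_le h1 le_rfl
    rw [ENNReal.coe_toNNReal (hg _).ne]
    exact h2.trans (hfg _ t).2
  -- A projection may lie in several families; assigning it to one makes the fibers of `idx`
  -- partition `G`, so each rank is counted once.
  choose! idx hidx using fun P (hP : P ∈ ⋃ i, F i) => Set.mem_iUnion.mp hP
  have hfiber : ∀ i : Fin (k + 1),
      ∑ P ∈ G with idx P = i, rank ((fun Y => (𝕎 t).nhd Y δ)^[m + 1] (ψ P)) ≤ n t := fun i => by
    refine sum_rank_le_of_mul_eq_zero _ _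
      (fun P _ => (𝕎 t).isStarProjection_iterate_nhd δ m _) fun P hP Q hQ hPQ => ?_
    rw [Finset.mem_filter] at hP hQ
    have hPS := hGS hP.1
    have hQS := hGS hQ.1
    rw [hψ P (hS P hPS).2, hψ Q (hS Q hQS).2]
    refine (φ t).iterate_nhd_mul_eq_zero 𝕍 (𝕎 t) mem_matrixAlgebra
      (hfr.le.trans (hfg r t).1) (hS P hPS).1 (hS Q hQS).1 ?_
    exact (hF i).2.2 P (hP.2 ▸ hidx P hPS) Q (hQ.2 ▸ hidx Q hQS) hPQ
  have hn0 : (0 : ℝ) < n t := by exact_mod_cast hn t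
  have hcontra : (1 + (ε : ℝ)) ^ (m + 1) * n t ≤ ((k : ℝ) + 1) * n t :=
    calc (1 + (ε : ℝ)) ^ (m + 1) * n t
        ≤ (1 + (ε : ℝ)) ^ (m + 1) * ∑ P ∈ G, (rank (ψ P) : ℝ) := by
          gcongr
          exact_mod_cast hG
      _ ≤ ∑ P ∈ G, (rank ((fun Y => (𝕎 t).nhd Y δ)^[m + 1] (ψ P)) : ℝ) := by
          rw [Finset.mul_sum]
          exact Finset.sum_le_sum hrank
      _ = ∑ i, ∑ P ∈ G with idx P = i,
            (rank ((fun Y => (𝕎 t).nhd Y δ)^[m + 1] (ψ P)) : ℝ) :=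
          (Finset.sum_fiberwise G idx _).symm
      _ ≤ ∑ _i : Fin (k + 1), (n t : ℝ) :=
          Finset.sum_le_sum fun i _ => by exact_mod_cast hfiber i
      _ = ((k : ℝ) + 1) * n t := by simp
  exact absurd (le_of_mul_le_mul_right hcontra hn0) (not_le.mpr hm1)

end QuantumMetricSpaces

theorem mainTheorem2 {H : Type*} [NormedAddCommGroup H] [InnerProductSpace ℂ H] [CompleteSpace H]
    (M : VonNeumannAlgebra H) (𝕍 : QuantumMetricSpaces.QuantumMetric M)
    (δ ε : ℝ≥0) (hδ : 0 < δ) (hε : 0 < ε)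
    (n : {t : ℝ≥0 // 0 < t} → ℕ) (hn : ∀ t, 1 ≤ n t)
    (𝕎 : ∀ t, QuantumMetricSpaces.QuantumMetric (QuantumMetricSpaces.matrixAlgebra (n t)))
    (hrefl : ∀ t, (𝕎 t).IsReflexive)
    (φ : ∀ t, QuantumMetricSpaces.QuantumFunction M (QuantumMetricSpaces.matrixAlgebra (n t)))
    (hφ : ∀ t, (φ t).IsCoarseEmbedding 𝕍 (𝕎 t))
    (hequi : QuantumMetricSpaces.IsEquiCoarse 𝕍 𝕎 φ)
    (hiso : ∀ t, QuantumMetricSpaces.IsoperimetricInequality (𝕎 t) δ ε t) :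
    𝕍.asdim = ⊤ :=
  QuantumMetricSpaces.asdim_eq_top_of_isEquiCoarse hδ hε hn hequi hiso
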